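/- Let $D$ be an integral domain with quotient field $K$. For a nonzero fractional ideal $I$ of $D$ put $I^{-1}=\{x\in K\mid xI\subseteq D\}$, $I_v=(I^{-1})^{-1}$, and let $I_t=\bigcup_H H_v$, where $H$ ranges over the nonzero finitely generated fractional ideals of $D$ contained in $I$. The domain $D$ is called *$t$-sharp* if, whenever $I$, $A$, $B$ are nonzero ideals of $D$ with $I\supseteq AB$, there exist nonzero ideals $H$ and $J$ of $D$ such that $I_t=(HJ)_t$, $H_t\supseteq A$ and $J_t\supseteq B$. Then an integral domain $D$ is $t$-sharp if and only if the polynomial ring $D[X]$ is $t$-sharp. -/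

import Mathlib

open scoped nonZeroDivisors

noncomputable section

namespace TSharp

variable {D : Type*} [CommRing D] [IsDomain D]

/-- The `v`-closure `I_v = (I⁻¹)⁻¹` of a fractional ideal of `D`, where
`I⁻¹ = (D : I) = {x ∈ K | x I ⊆ D}` and `K` is the quotient field of `D`.
For `I = 0`, which is not used, the value is `0`. -/
def vClosure (I : FractionalIdeal D⁰ (FractionRing D)) :
    FractionalIdeal D⁰ (FractionRing D) :=
  1 / (1 / I)

theorem inv_ne_zero_of_ne_zero {I : FractionalIdeal D⁰ (FractionRing D)} (hI : I ≠ 0) :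
    1 / I ≠ 0 := by
  obtain ⟨a, J, ha, rfl⟩ := FractionalIdeal.exists_eq_spanSingleton_mul I
  have ha' : algebraMap D (FractionRing D) a ≠ 0 := by
    simpa using ha
  intro h
  have hmem : algebraMap D (FractionRing D) a ∈
      (1 : FractionalIdeal D⁰ (FractionRing D)) /
        (FractionalIdeal.spanSingleton D⁰ (algebraMap D (FractionRing D) a)⁻¹ * ↑J) := by
    rw [FractionalIdeal.mem_div_iff_of_ne_zero hI]
    intro y hy
    obtain ⟨z, hz, rfl⟩ := FractionalIdeal.mem_singleton_mul.mp hy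
    rw [mul_inv_cancel_left₀ ha']
    exact FractionalIdeal.coeIdeal_le_one hz
  rw [h] at hmem
  exact ha' (by simpa using hmem)

theorem vClosure_mono {I J : FractionalIdeal D⁰ (FractionRing D)} (h : I ≤ J) :
    vClosure I ≤ vClosure J := by
  by_cases hI : I = 0
  · subst hI
    simp [vClosure]
  have hJ : J ≠ 0 := fun hJ => hI (le_antisymm (hJ ▸ h) (FractionalIdeal.zero_le _))
  have hI' : 1 / I ≠ 0 := inv_ne_zero_of_ne_zero hI
  have hJ' : 1 / J ≠ 0 := inv_ne_zero_of_ne_zero hJ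
  intro x hx
  rw [vClosure, FractionalIdeal.mem_div_iff_of_ne_zero hI'] at hx
  rw [vClosure, FractionalIdeal.mem_div_iff_of_ne_zero hJ']
  intro y hy
  apply hx
  rw [FractionalIdeal.mem_div_iff_of_ne_zero hJ] at hy
  rw [FractionalIdeal.mem_div_iff_of_ne_zero hI]
  exact fun z hz => hy z (h hz)

/-- The `t`-closure `I_t = ⋃ H_v`, where `H` ranges over the finitely generated fractional
ideals contained in `I`. (Admitting `H = 0` only adds the element `0`, which lies in every
other `H_v`.) -/
def tClosure (I : FractionalIdeal D⁰ (FractionRing D)) :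
    FractionalIdeal D⁰ (FractionRing D) :=
  ⟨{ carrier := {x | ∃ H : FractionalIdeal D⁰ (FractionRing D),
        H ≤ I ∧ (H : Submodule D (FractionRing D)).FG ∧ x ∈ vClosure H}
     zero_mem' := ⟨0, FractionalIdeal.zero_le I, by
        rw [FractionalIdeal.coe_zero]; exact Submodule.fg_bot, by simp [vClosure]⟩
     add_mem' := by
        rintro x y ⟨H, hH, hHf, hx⟩ ⟨J, hJ, hJf, hy⟩
        refine ⟨H ⊔ J, sup_le hH hJ, ?_, ?_⟩
        · rw [FractionalIdeal.coe_sup]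
          exact hHf.sup hJf
        · exact (vClosure (H ⊔ J)).val.add_mem (vClosure_mono le_sup_left hx)
            (vClosure_mono le_sup_right hy)
     smul_mem' := by
        rintro c x ⟨H, hH, hHf, hx⟩
        exact ⟨H, hH, hHf, (vClosure H).val.smul_mem c hx⟩ },
   FractionalIdeal.isFractional_of_le (J := vClosure I)
      (by rintro x ⟨H, hH, _, hx⟩; exact vClosure_mono hH hx)⟩

/-- A domain `D` is `t`-sharp if, for all nonzero ideals `I`, `A`, `B` of `D` with `I ⊇ AB`, there
are nonzero ideals `H` and `J` of `D` with `I_t = (HJ)_t`, `H_t ⊇ A` and `J_t ⊇ B`. -/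
def IsTSharp (D : Type*) [CommRing D] [IsDomain D] : Prop :=
  ∀ I A B : Ideal D, I ≠ ⊥ → A ≠ ⊥ → B ≠ ⊥ → A * B ≤ I →
    ∃ H J : Ideal D, H ≠ ⊥ ∧ J ≠ ⊥ ∧
      tClosure (I : FractionalIdeal D⁰ (FractionRing D)) =
        tClosure ((H * J : Ideal D) : FractionalIdeal D⁰ (FractionRing D)) ∧
      (A : FractionalIdeal D⁰ (FractionRing D)) ≤ tClosure H ∧
      (B : FractionalIdeal D⁰ (FractionRing D)) ≤ tClosure J

end TSharp

end

/-! For an integral ideal, x lies in I_v iff b ∣ aI forces b ∣ ax for all a, b, so both closures can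
be handled by divisibility in the ring. Taking I = (a) and B = (a) : A in the definition shows that
a t-sharp domain is integrally closed and that its nonzero finitely generated ideals are
t-invertible. Over an integrally closed domain Gauss's lemma holds up to closure: C d ∣ pq implies d
∣ p_i q_j. Hence (d, q)_v contains every coefficient of q, for any constant d ≠ 0. From D[X] to D:
the t-ideals obtained from extended ideals contain nonzero constants, so by the last remark they are
themselves extended and can be contracted to D. From D to D[X]: let f ∈ I generate I K[X], and let
c(I) be the ideal of all coefficients. Then I_t = ((f K[X] ∩ D[X]) · c(I)[X])_t. The two factors can
be split separately: f up to a unit in the PID K[X], and c(I) by t-sharpness of D. The inclusion of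
I in the right side needs t-invertibility of contents; the other needs Gauss's lemma. -/

namespace TSharp

/-! ### The v- and t-closures of integral ideals. -/

section Closure

variable {R : Type*} [CommRing R]

/-- The `v`-closure of an ideal, in terms of divisibility. -/
def vcl (I : Ideal R) : Ideal R where
  carrier := {x | ∀ a b : R, (∀ s ∈ I, b ∣ a * s) → b ∣ a * x}
  zero_mem' := fun a b _ => by simp
  add_mem' := fun hx hy a b h => by
    rw [mul_add]
    exact dvd_add (hx a b h) (hy a b h)
  smul_mem' := fun c x hx a b h => by
    rw [smul_eq_mul, mul_left_comm]
    exact Dvd.dvd.mul_left (hx a b h) c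

theorem mem_vcl {I : Ideal R} {x : R} :
    x ∈ vcl I ↔ ∀ a b : R, (∀ s ∈ I, b ∣ a * s) → b ∣ a * x := Iff.rfl

theorem le_vcl (I : Ideal R) : I ≤ vcl I := fun x hx _ _ h => h x hx

theorem vcl_mono {I J : Ideal R} (h : I ≤ J) : vcl I ≤ vcl J :=
  fun _ hx a b hab => hx a b fun s hs => hab s (h hs)

theorem vcl_le_vcl {I J : Ideal R} (h : I ≤ vcl J) : vcl I ≤ vcl J :=
  fun _ hx a b hab => hx a b fun _ hs => h hs a b hab

theorem mul_vcl_le (I J : Ideal R) : I * vcl J ≤ vcl (I * J) := by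
  rw [Ideal.mul_le]
  intro r hr s hs a b hab
  rw [← mul_assoc]
  refine hs (a * r) b fun t ht => ?_
  rw [mul_assoc]
  exact hab _ (Ideal.mul_mem_mul hr ht)

theorem vcl_mul_vcl_le (I J : Ideal R) : vcl I * vcl J ≤ vcl (I * J) := by
  refine (mul_vcl_le _ _).trans (vcl_le_vcl ?_)
  rw [mul_comm, mul_comm I]
  exact mul_vcl_le _ _

theorem vcl_span_singleton (a : R) : vcl (Ideal.span {a}) = Ideal.span {a} := by
  refine le_antisymm (fun x hx => ?_) (le_vcl _)
  have := hx 1 a fun s hs => by simpa using Ideal.mem_span_singleton.mp hs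
  simpa [Ideal.mem_span_singleton] using this

/-- The `t`-closure of an ideal, in terms of divisibility. -/
def tcl (I : Ideal R) : Ideal R where
  carrier := {x | ∃ H ≤ I, H.FG ∧ x ∈ vcl H}
  zero_mem' := ⟨⊥, bot_le, Submodule.fg_bot, zero_mem _⟩
  add_mem' := by
    rintro x y ⟨H, hH, hHf, hx⟩ ⟨J, hJ, hJf, hy⟩
    exact ⟨H ⊔ J, sup_le hH hJ, Submodule.FG.sup hHf hJf,
      add_mem (vcl_mono le_sup_left hx) (vcl_mono le_sup_right hy)⟩
  smul_mem' := by
    rintro c x ⟨H, hH, hHf, hx⟩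
    exact ⟨H, hH, hHf, Ideal.mul_mem_left _ c hx⟩

theorem mem_tcl {I : Ideal R} {x : R} : x ∈ tcl I ↔ ∃ H ≤ I, H.FG ∧ x ∈ vcl H := Iff.rfl

theorem tcl_le_vcl (I : Ideal R) : tcl I ≤ vcl I := by
  rintro x ⟨H, hH, _, hx⟩
  exact vcl_mono hH hx

theorem vcl_le_tcl {I : Ideal R} (hI : I.FG) : vcl I ≤ tcl I := fun _ hx => ⟨I, le_rfl, hI, hx⟩

theorem le_tcl (I : Ideal R) : I ≤ tcl I := fun x hx =>
  ⟨Ideal.span {x}, by simpa [Ideal.span_le] using hx, Submodule.fg_span_singleton x,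
    le_vcl _ (Ideal.mem_span_singleton_self x)⟩

theorem tcl_mono {I J : Ideal R} (h : I ≤ J) : tcl I ≤ tcl J := by
  rintro x ⟨H, hH, hHf, hx⟩
  exact ⟨H, hH.trans h, hHf, hx⟩

theorem exists_fg_le_vcl_of_le_tcl {I H : Ideal R} (hH : H.FG) (h : H ≤ tcl I) :
    ∃ J ≤ I, J.FG ∧ H ≤ vcl J := by
  induction H, hH using Submodule.fg_induction with
  | singleton x =>
    obtain ⟨J, hJ, hJf, hx⟩ := h (Ideal.mem_span_singleton_self x)
    exact ⟨J, hJ, hJf, by simpa [Submodule.span_le] using hx⟩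
  | sup M N _ _ hM hN =>
    obtain ⟨J, hJ, hJf, hx⟩ := hM (le_sup_left.trans h)
    obtain ⟨J', hJ', hJf', hx'⟩ := hN (le_sup_right.trans h)
    exact ⟨J ⊔ J', sup_le hJ hJ', Submodule.FG.sup hJf hJf',
      sup_le (hx.trans (vcl_mono le_sup_left)) (hx'.trans (vcl_mono le_sup_right))⟩

theorem tcl_le_tcl {I J : Ideal R} (h : I ≤ tcl J) : tcl I ≤ tcl J := by
  rintro x ⟨H, hH, hHf, hx⟩
  obtain ⟨K, hK, hKf, hHK⟩ := exists_fg_le_vcl_of_le_tcl hHf (hH.trans h)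
  exact ⟨K, hK, hKf, vcl_le_vcl hHK hx⟩

theorem tcl_tcl_le (I : Ideal R) : tcl (tcl I) ≤ tcl I := tcl_le_tcl le_rfl

theorem mul_tcl_le (I J : Ideal R) : I * tcl J ≤ tcl (I * J) := by
  rw [Ideal.mul_le]
  rintro r hr s ⟨H, hH, hHf, hs⟩
  refine ⟨Ideal.span {r} * H, Ideal.mul_mono (by simpa [Ideal.span_le] using hr) hH,
    (Submodule.fg_span_singleton r).mul hHf, ?_⟩
  exact mul_vcl_le _ _ (Ideal.mul_mem_mul (Ideal.mem_span_singleton_self r) hs)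

theorem tcl_mul_tcl_le (I J : Ideal R) : tcl I * tcl J ≤ tcl (I * J) := by
  refine (mul_tcl_le _ _).trans (tcl_le_tcl ?_)
  rw [mul_comm, mul_comm I]
  exact mul_tcl_le _ _

theorem mul_le_tcl_mul {I I' J J' : Ideal R} (h : I ≤ tcl I') (h' : J ≤ tcl J') :
    I * J ≤ tcl (I' * J') :=
  (Ideal.mul_mono h h').trans (tcl_mul_tcl_le _ _)

theorem tcl_span_singleton (a : R) : tcl (Ideal.span {a}) = Ideal.span {a} :=
  le_antisymm ((tcl_le_vcl _).trans (vcl_span_singleton a).le) (le_tcl _)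

/-- A finitely generated ideal inside cI is c times a finitely generated ideal inside I, and
v-closure commutes with multiplication by c. -/
theorem mem_tcl_of_mul_mem [IsDomain R] {I : Ideal R} {c x : R} (hc : c ≠ 0)
    (h : c * x ∈ tcl (Ideal.span {c} * I)) : x ∈ tcl I := by
  obtain ⟨H, hH, hHf, hx⟩ := h
  have hinj : Function.Injective (LinearMap.mulLeft R c) := fun y z hyz =>
    mul_left_cancel₀ hc hyz
  have hHmap : Submodule.map (LinearMap.mulLeft R c) (Submodule.comap (LinearMap.mulLeft R c) H) =
      H := by
    refine Submodule.map_comap_eq_of_le fun y hy => ?_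
    obtain ⟨z, _, rfl⟩ := Ideal.mem_span_singleton_mul.mp (hH hy)
    exact ⟨z, rfl⟩
  refine ⟨Submodule.comap (LinearMap.mulLeft R c) H, fun y hy => ?_,
    Submodule.fg_of_fg_map_injective _ hinj (by rwa [hHmap]), fun a b hab => ?_⟩
  · obtain ⟨z, hz, hzy⟩ := Ideal.mem_span_singleton_mul.mp (hH hy)
    rwa [← mul_left_cancel₀ hc hzy]
  · have := hx a (c * b) fun s hs => by
      rw [← hHmap] at hs
      obtain ⟨y, hy, rfl⟩ := hs
      rw [LinearMap.mulLeft_apply, mul_left_comm]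
      exact mul_dvd_mul_left c (hab y hy)
    rw [mul_left_comm] at this
    exact (mul_dvd_mul_iff_left hc).mp this

end Closure

/-! ### Comparison with the closures of fractional ideals. -/

section Bridge

variable {D : Type*} [CommRing D] [IsDomain D]

theorem mem_one_div_coeIdeal {H : Ideal D} (hH : H ≠ ⊥) {y : FractionRing D} :
    y ∈ 1 / (H : FractionalIdeal D⁰ (FractionRing D)) ↔
      ∀ s ∈ H, ∃ r : D, algebraMap D (FractionRing D) r = y * algebraMap D (FractionRing D) s := by
  rw [FractionalIdeal.mem_div_iff_of_ne_zero (by simpa using hH)]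
  simp [FractionalIdeal.mem_coeIdeal, FractionalIdeal.mem_one_iff]

theorem mem_vClosure_coeIdeal (H : Ideal D) (x : FractionRing D) :
    x ∈ vClosure (H : FractionalIdeal D⁰ (FractionRing D)) ↔
      ∃ z ∈ vcl H, algebraMap D (FractionRing D) z = x := by
  by_cases hH : H = ⊥
  · subst hH
    have hbot : vcl (⊥ : Ideal D) = ⊥ := by
      rw [← Ideal.span_singleton_zero, vcl_span_singleton]
    simp [vClosure, hbot, eq_comm]
  have hH' : 1 / (H : FractionalIdeal D⁰ (FractionRing D)) ≠ 0 :=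
    inv_ne_zero_of_ne_zero (by simpa using hH)
  obtain ⟨s, hs, hs0⟩ := Submodule.exists_mem_ne_zero_of_ne_bot hH
  have hinj := IsFractionRing.injective D (FractionRing D)
  rw [vClosure, FractionalIdeal.mem_div_iff_of_ne_zero hH']
  constructor
  · intro h
    obtain ⟨z, hz⟩ := (FractionalIdeal.mem_one_iff _).mp
      (h 1 ((mem_one_div_coeIdeal hH).mpr fun s _ => ⟨s, by simp⟩))
    rw [mul_one] at hz
    refine ⟨z, fun a b hab => ?_, hz⟩
    -- The fraction a/b needs b ≠ 0; when b = 0, the nonzero s ∈ H forces a = 0.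
    by_cases hb : b = 0
    · have := hab s hs
      simp only [hb, zero_dvd_iff, mul_eq_zero, hs0, or_false] at this ⊢
      exact Or.inl this
    have hb' : algebraMap D (FractionRing D) b ≠ 0 := by simpa using hb
    obtain ⟨r, hr⟩ := (FractionalIdeal.mem_one_iff _).mp
      (h (algebraMap D _ a / algebraMap D _ b) ((mem_one_div_coeIdeal hH).mpr fun s hs => by
        obtain ⟨c, hc⟩ := hab s hs
        refine ⟨c, ?_⟩
        rw [div_mul_eq_mul_div, eq_div_iff hb', ← map_mul, ← map_mul, hc, mul_comm]))
    refine ⟨r, hinj ?_⟩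
    rw [map_mul, map_mul, hr, ← hz]
    field_simp
  · rintro ⟨z, hz, rfl⟩ y hy
    rw [mem_one_div_coeIdeal hH] at hy
    obtain ⟨a, b, hb, rfl⟩ := IsFractionRing.div_surjective (A := D) y
    have hb' : algebraMap D (FractionRing D) b ≠ 0 := by
      simpa using nonZeroDivisors.ne_zero hb
    obtain ⟨r, hr⟩ := hz a b fun s hs => by
      obtain ⟨r, hr⟩ := hy s hs
      refine ⟨r, hinj ?_⟩
      rw [map_mul, map_mul, hr]
      field_simp
    refine (FractionalIdeal.mem_one_iff _).mpr ⟨r, ?_⟩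
    rw [mul_div_assoc', eq_div_iff hb', ← map_mul, ← map_mul, mul_comm z, hr, mul_comm]

theorem tClosure_coeIdeal (I : Ideal D) :
    tClosure (I : FractionalIdeal D⁰ (FractionRing D)) = (tcl I : Ideal D) := by
  have hinj := IsFractionRing.injective D (FractionRing D)
  ext x
  rw [FractionalIdeal.mem_coeIdeal]
  constructor
  · rintro ⟨H, hH, hHf, hx⟩
    obtain ⟨H', rfl⟩ := FractionalIdeal.le_one_iff_exists_coeIdeal.mp
      (hH.trans FractionalIdeal.coeIdeal_le_one)
    obtain ⟨z, hz, rfl⟩ := (mem_vClosure_coeIdeal H' x).mp hx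
    refine ⟨z, ⟨H', (FractionalIdeal.coeIdeal_le_coeIdeal _).mp hH, ?_, hz⟩, rfl⟩
    rwa [FractionalIdeal.coe_coeIdeal, IsLocalization.coeSubmodule_fg _ hinj] at hHf
  · rintro ⟨z, ⟨H, hH, hHf, hz⟩, rfl⟩
    refine ⟨H, (FractionalIdeal.coeIdeal_le_coeIdeal _).mpr hH, ?_,
      (mem_vClosure_coeIdeal H _).mpr ⟨z, hz, rfl⟩⟩
    rwa [FractionalIdeal.coe_coeIdeal, IsLocalization.coeSubmodule_fg _ hinj]

theorem isTSharp_iff : IsTSharp D ↔ ∀ I A B : Ideal D, I ≠ ⊥ → A ≠ ⊥ → B ≠ ⊥ → A * B ≤ I →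
    ∃ H J : Ideal D, H ≠ ⊥ ∧ J ≠ ⊥ ∧ tcl I = tcl (H * J) ∧ A ≤ tcl H ∧ B ≤ tcl J := by
  simp only [IsTSharp, tClosure_coeIdeal, FractionalIdeal.coeIdeal_le_coeIdeal,
    FractionalIdeal.coeIdeal_inj]

end Bridge

/-! ### t-invertibility and integral closedness of t-sharp domains. -/

section Invertible

variable {D : Type*} [CommRing D] [IsDomain D]

/-- Split (a) ⊇ A · ((a) : A) with 0 ≠ a ∈ A. Since H_t J_t ⊆ (a), the factors are forced: J ⊆ (a) :
A and H ⊆ A_v. -/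
theorem IsTSharp.exists_mul_le_span_singleton (h : IsTSharp D) {A : Ideal D} (hA : A ≠ ⊥) :
    ∃ (a : D) (B : Ideal D), a ≠ 0 ∧ A * B ≤ Ideal.span {a} ∧ a ∈ tcl (vcl A * B) := by
  obtain ⟨a, ha, ha0⟩ := Submodule.exists_mem_ne_zero_of_ne_bot hA
  have hmem {x : D} : x ∈ (Ideal.span {a}).colon (A : Set D) ↔ ∀ y ∈ A, a ∣ x * y := by
    simp [Submodule.mem_colon, Ideal.mem_span_singleton]
  have hAB : A * (Ideal.span {a}).colon (A : Set D) ≤ Ideal.span {a} := by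
    rw [Ideal.mul_le]
    intro r hr s hs
    rw [Ideal.mem_span_singleton, mul_comm]
    exact hmem.mp hs r hr
  obtain ⟨H, J, _, _, hHJ, hAH, hBJ⟩ := isTSharp_iff.mp h (Ideal.span {a}) A
    ((Ideal.span {a}).colon (A : Set D)) (by simpa using ha0) hA
    (fun hbot => ha0 (by
      rw [← Ideal.mem_bot, ← hbot, hmem]
      exact fun y _ => dvd_mul_right a y)) hAB
  rw [tcl_span_singleton] at hHJ
  have hprod : tcl H * tcl J ≤ Ideal.span {a} := (tcl_mul_tcl_le H J).trans hHJ.ge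
  refine ⟨a, _, ha0, hAB, ?_⟩
  have hH : H ≤ vcl A := by
    intro x hx c b hcb
    by_cases hb : b = 0
    · have := hcb a ha
      simp only [hb, zero_dvd_iff, mul_eq_zero, ha0, or_false] at this ⊢
      exact Or.inl this
    -- Here e = ca/b lies in (a) : A, so a ∣ xe, which is b ∣ cx.
    obtain ⟨e, he⟩ := hcb a ha
    have heB : e ∈ (Ideal.span {a}).colon (A : Set D) := hmem.mpr fun y hy => by
      obtain ⟨w, hw⟩ := hcb y hy
      exact ⟨w, mul_left_cancel₀ hb (by linear_combination a * hw - y * he)⟩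
    obtain ⟨w, hw⟩ := Ideal.mem_span_singleton.mp
      (hprod (Ideal.mul_mem_mul (le_tcl H hx) (hBJ heB)))
    exact ⟨w, mul_left_cancel₀ ha0 (by linear_combination b * hw + x * he)⟩
  have hJ : J ≤ (Ideal.span {a}).colon (A : Set D) := fun x hx => hmem.mpr fun y hy => by
    rw [mul_comm]
    exact Ideal.mem_span_singleton.mp (hprod (Ideal.mul_mem_mul (hAH hy) (le_tcl J hx)))
  exact tcl_mono (Ideal.mul_mono hH hJ) (hHJ ▸ Ideal.mem_span_singleton_self a)

theorem IsTSharp.exists_mul_le_span_singleton_of_fg (h : IsTSharp D) {A : Ideal D} (hA : A ≠ ⊥)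
    (hAf : A.FG) :
    ∃ (a : D) (B : Ideal D), a ≠ 0 ∧ A * B ≤ Ideal.span {a} ∧ a ∈ tcl (A * B) := by
  obtain ⟨a, B, ha, hAB, haB⟩ := h.exists_mul_le_span_singleton hA
  exact ⟨a, B, ha, hAB, tcl_le_tcl (mul_le_tcl_mul (vcl_le_tcl hAf) (le_tcl B)) haB⟩

/-- If all r xⁿ lie in D, they generate an ideal A with xA ⊆ A. As AB ⊆ (a) and a ∈ (AB)_v, it
follows that xa ∈ aD. -/
theorem IsTSharp.isIntegrallyClosed (h : IsTSharp D) : IsIntegrallyClosed D := by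
  rw [isIntegrallyClosed_iff (FractionRing D)]
  intro x hx
  have hinj := IsFractionRing.injective D (FractionRing D)
  obtain ⟨r, hr, hrx⟩ := hx.isAlmostIntegral
  obtain ⟨p, q, hq, rfl⟩ := IsFractionRing.div_surjective (A := D) x
  have hq0 : q ≠ 0 := nonZeroDivisors.ne_zero hq
  have hq' : algebraMap D (FractionRing D) q ≠ 0 := by simpa using hq0
  set x := algebraMap D (FractionRing D) p / algebraMap D (FractionRing D) q with hxdef
  have hxq : algebraMap D (FractionRing D) q * x = algebraMap D (FractionRing D) p := by
    rw [hxdef]; field_simp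
  let A : Ideal D := Ideal.span {y | ∃ n : ℕ, algebraMap D (FractionRing D) y = r • x ^ n}
  have hrA : r ∈ A := Ideal.subset_span ⟨0, by simp [Algebra.smul_def]⟩
  have hA : A ≠ ⊥ := fun hbot => nonZeroDivisors.ne_zero hr (by simpa [hbot] using hrA)
  have hstep (y : D) (hy : y ∈ A) : ∃ z ∈ A, p * y = q * z := by
    induction hy using Submodule.span_induction with
    | mem y hy =>
      obtain ⟨n, hn⟩ := hy
      obtain ⟨z, hz⟩ := hrx (n + 1)
      refine ⟨z, Ideal.subset_span ⟨n + 1, hz⟩, hinj ?_⟩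
      rw [map_mul, map_mul, hn, hz, ← hxq, Algebra.smul_def, Algebra.smul_def]
      ring
    | zero => exact ⟨0, zero_mem _, by simp⟩
    | add y z _ _ hy hz =>
      obtain ⟨y', hy', hy⟩ := hy
      obtain ⟨z', hz', hz⟩ := hz
      exact ⟨y' + z', add_mem hy' hz', by rw [mul_add, hy, hz, mul_add]⟩
    | smul c y _ hy =>
      obtain ⟨y', hy', hy⟩ := hy
      exact ⟨c * y', A.mul_mem_left c hy', by rw [smul_eq_mul, mul_left_comm, hy, mul_left_comm]⟩
  obtain ⟨a, B, ha, hAB, haB⟩ := h.exists_mul_le_span_singleton hA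
  have hav : a ∈ vcl (A * B) :=
    vcl_le_vcl ((Ideal.mul_mono_right (le_vcl B)).trans (vcl_mul_vcl_le A B)) (tcl_le_vcl _ haB)
  obtain ⟨w, hw⟩ := hav p (a * q) fun s hs => by
    induction hs using Submodule.mul_induction_on' with
    | mem_mul_mem y hy b hb =>
      obtain ⟨z, hz, hyz⟩ := hstep y hy
      obtain ⟨w, hw⟩ := Ideal.mem_span_singleton.mp (hAB (Ideal.mul_mem_mul hz hb))
      exact ⟨w, by linear_combination b * hyz + q * hw⟩
    | add y _ z _ hy hz =>
      rw [mul_add]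
      exact dvd_add hy hz
  refine ⟨w, mul_left_cancel₀ hq' ?_⟩
  rw [hxq, ← map_mul]
  exact congrArg _ (mul_left_cancel₀ ha (by linear_combination -hw))

end Invertible

open Polynomial

/-! ### Gauss's lemma over integrally closed domains. -/

section Gauss

theorem dvd_coeff_mul_coeff_of_isGCDMonoid {V : Type*} [CommRing V] [IsDomain V] [IsBezout V]
    {d : V} {p q : V[X]} (h : C d ∣ p * q) (i j : ℕ) : d ∣ p.coeff i * q.coeff j := by
  classical
  let : GCDMonoid V := IsBezout.toGCDDomain V
  let : NormalizationMonoid V := Classical.choice inferInstance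
  let : NormalizedGCDMonoid V := Classical.choice inferInstance
  exact ((dvd_content_iff_C_dvd.mpr h).trans (associated_content_mul p q).dvd).trans
    (mul_dvd_mul (content_dvd_coeff i) (content_dvd_coeff j))

variable {D : Type*} [CommRing D] [IsDomain D]

/-- If u = p_i q_j / d were not integral over D, some valuation ring of K containing D would omit u;
but valuation rings are Bézout, so content is multiplicative there and u belongs to it. -/
theorem dvd_coeff_mul_coeff [IsIntegrallyClosed D] {d : D} {p q : D[X]} (h : C d ∣ p * q)
    (i j : ℕ) : d ∣ p.coeff i * q.coeff j := by
  by_cases hd : d = 0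
  · subst hd
    rw [C_0, zero_dvd_iff, mul_eq_zero] at h
    rcases h with rfl | rfl <;> simp
  have hinj := IsFractionRing.injective D (FractionRing D)
  have hd' : algebraMap D (FractionRing D) d ≠ 0 := by simpa using hd
  set u := algebraMap D (FractionRing D) (p.coeff i * q.coeff j) /
    algebraMap D (FractionRing D) d with hu
  by_cases hint : IsIntegral D u
  · obtain ⟨y, hy⟩ := IsIntegrallyClosed.isIntegral_iff.mp hint
    refine ⟨y, hinj ?_⟩
    rw [map_mul _ d, hy, hu]
    field_simp
  exfalso
  have : IsIntegrallyClosedIn (integralClosure D (FractionRing D)).toSubring (FractionRing D) :=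
    Subring.isIntegrallyClosedIn_iff.mpr fun {x} hx =>
      isIntegral_trans (A := integralClosure D (FractionRing D)) x hx
  obtain ⟨V, hV, huV⟩ := Subring.exists_le_valuationSubring_of_isIntegrallyClosedIn
    (R := (integralClosure D (FractionRing D)).toSubring) (x := u) hint
  let φ : D →+* V := (algebraMap D (FractionRing D)).codRestrict V.toSubring fun x =>
    hV (algebraMap_mem (integralClosure D (FractionRing D)) x)
  have hdvd : C (φ d) ∣ p.map φ * q.map φ := by
    rw [← map_C, ← Polynomial.map_mul]
    exact Polynomial.map_dvd φ h
  obtain ⟨w, hw⟩ := dvd_coeff_mul_coeff_of_isGCDMonoid hdvd i j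
  rw [coeff_map, coeff_map, ← map_mul] at hw
  have hw' : algebraMap D (FractionRing D) (p.coeff i * q.coeff j) =
    algebraMap D (FractionRing D) d * (w : FractionRing D) := congrArg Subtype.val hw
  apply huV
  rw [hu, hw', mul_div_cancel_left₀ _ hd']
  exact w.2

theorem isIntegrallyClosed_of_polynomial [IsIntegrallyClosed D[X]] : IsIntegrallyClosed D := by
  rw [isIntegrallyClosed_iff (FractionRing D)]
  intro x hx
  have hinj := IsFractionRing.injective D (FractionRing D)
  obtain ⟨p, q, hq, rfl⟩ := IsFractionRing.div_surjective (A := D) x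
  have hq0 : q ≠ 0 := nonZeroDivisors.ne_zero hq
  have hq' : algebraMap D (FractionRing D) q ≠ 0 := by simpa using hq0
  let ψ : FractionRing D →+* FractionRing D[X] := IsFractionRing.map (A := D) (B := D[X])
    (j := C) C_injective
  have hψ (y : D) : ψ (algebraMap D _ y) = algebraMap D[X] _ (C y) :=
    IsLocalization.map_eq _ y
  have hint : IsIntegral D[X] (ψ (algebraMap D _ p / algebraMap D _ q)) :=
    hx.map_of_comp_eq (C : D →+* D[X]) ψ (by ext y; simp [hψ])
  obtain ⟨f, hf⟩ := IsIntegrallyClosed.isIntegral_iff.mp hint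
  have hne : algebraMap D[X] (FractionRing D[X]) (C q) ≠ 0 := by simpa using hq0
  rw [map_div₀, hψ, hψ, eq_div_iff hne, ← map_mul] at hf
  have h0 := congrArg (fun f => coeff f 0) (IsFractionRing.injective D[X] (FractionRing D[X]) hf)
  simp only [coeff_mul_C, coeff_C_zero] at h0
  exact ⟨f.coeff 0, by rw [eq_div_iff hq', ← map_mul, h0]⟩

end Gauss

/-! ### Closures of ideals extended to D[X]. -/

section Extension

variable {D : Type*} [CommRing D]

theorem map_vcl_le [IsDomain D] (I : Ideal D) : (vcl I).map C ≤ vcl (I.map (C : D →+* D[X])) := by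
  rw [Ideal.map_le_iff_le_comap]
  intro x hx a b hab
  by_cases hI : I = ⊥
  · subst hI
    rw [← Ideal.span_singleton_zero, vcl_span_singleton, Ideal.mem_span_singleton,
      zero_dvd_iff] at hx
    simp [hx]
  obtain ⟨s, hs, hs0⟩ := Submodule.exists_mem_ne_zero_of_ne_bot hI
  obtain ⟨p, hp⟩ := hab _ (Ideal.mem_map_of_mem C hs)
  have hCs : (C s : D[X]) ≠ 0 := by simpa using hs0
  by_cases hb : b = 0
  · simp only [hb, zero_mul, mul_eq_zero, hCs, or_false] at hp
    simp [hp]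
  -- As a/b = p/s, the hypothesis says that each p_i/s lies in I⁻¹, so it multiplies x ∈ I_v into D.
  have hdvd : C s ∣ p * C x := by
    rw [C_dvd_iff_dvd_coeff]
    intro i
    rw [coeff_mul_C]
    refine hx _ _ fun t ht => ?_
    obtain ⟨r, hr⟩ := hab _ (Ideal.mem_map_of_mem C ht)
    have : p * C t = C s * r := mul_left_cancel₀ hb (by linear_combination C s * hr - C t * hp)
    rw [← coeff_mul_C, this, coeff_C_mul]
    exact dvd_mul_right _ _
  obtain ⟨r, hr⟩ := hdvd
  exact ⟨r, mul_left_cancel₀ hCs (by linear_combination C x * hp + b * hr)⟩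

theorem map_tcl_le [IsDomain D] (I : Ideal D) : (tcl I).map C ≤ tcl (I.map (C : D →+* D[X])) := by
  rw [Ideal.map_le_iff_le_comap]
  rintro x ⟨H, hH, hHf, hx⟩
  exact ⟨H.map C, Ideal.map_mono hH, hHf.map C, map_vcl_le H (Ideal.mem_map_of_mem C hx)⟩

theorem map_le_tcl_map [IsDomain D] {I J : Ideal D} (h : I ≤ tcl J) :
    I.map (C : D →+* D[X]) ≤ tcl (J.map C) :=
  (Ideal.map_mono h).trans (map_tcl_le J)

theorem coeff_mem_vcl {I : Ideal D} {f : D[X]} (hf : f ∈ vcl (I.map (C : D →+* D[X]))) (i : ℕ) :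
    f.coeff i ∈ vcl I := by
  intro a b hab
  have := hf (C a) (C b) fun s hs => by
    rw [C_dvd_iff_dvd_coeff]
    intro j
    rw [coeff_C_mul]
    exact hab _ (Ideal.mem_map_C_iff.mp hs j)
  rw [C_dvd_iff_dvd_coeff] at this
  simpa using this i

theorem exists_fg_le_map_of_fg {I : Ideal D} {H : Ideal D[X]} (hH : H.FG) (h : H ≤ I.map C) :
    ∃ J ≤ I, J.FG ∧ H ≤ J.map C := by
  induction H, hH using Submodule.fg_induction with
  | singleton f =>
    have hf := Ideal.mem_map_C_iff.mp (h (Ideal.mem_span_singleton_self f))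
    refine ⟨f.contentIdeal, ?_, contentIdeal_FG f, ?_⟩
    · rw [contentIdeal_def, Ideal.span_le]
      intro x hx
      obtain ⟨n, _, rfl⟩ := mem_coeffs_iff.mp hx
      exact hf n
    · rw [Submodule.span_singleton_le_iff_mem, Ideal.mem_map_C_iff]
      exact fun n => coeff_mem_contentIdeal _ n
  | sup M N _ _ hM hN =>
    obtain ⟨J, hJ, hJf, hx⟩ := hM (le_sup_left.trans h)
    obtain ⟨J', hJ', hJf', hx'⟩ := hN (le_sup_right.trans h)
    exact ⟨J ⊔ J', sup_le hJ hJ', Submodule.FG.sup hJf hJf',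
      sup_le (hx.trans (Ideal.map_mono le_sup_left)) (hx'.trans (Ideal.map_mono le_sup_right))⟩

theorem coeff_mem_tcl {I : Ideal D} {f : D[X]} (hf : f ∈ tcl (I.map (C : D →+* D[X]))) (i : ℕ) :
    f.coeff i ∈ tcl I := by
  obtain ⟨H, hH, hHf, hx⟩ := hf
  obtain ⟨J, hJ, hJf, hHJ⟩ := exists_fg_le_map_of_fg hHf hH
  exact ⟨J, hJ, hJf, coeff_mem_vcl (vcl_mono hHJ hx) i⟩

theorem tcl_le_tcl_of_map_le {I J : Ideal D}
    (h : tcl (I.map (C : D →+* D[X])) ≤ tcl (J.map C)) : tcl I ≤ tcl J :=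
  tcl_le_tcl fun x hx => by
    simpa using coeff_mem_tcl (h (le_tcl _ (Ideal.mem_map_of_mem C hx))) 0

theorem map_C_ne_bot {I : Ideal D} (hI : I ≠ ⊥) : I.map (C : D →+* D[X]) ≠ ⊥ := fun h =>
  hI ((Ideal.map_eq_bot_iff_of_injective C_injective).mp h)

/-- Over an integrally closed domain, the `v`-closure of an ideal generated by a nonzero constant
and a polynomial contains the coefficients of the polynomial. -/
theorem C_coeff_mem_vcl [IsDomain D] [IsIntegrallyClosed D] {d : D} (hd : d ≠ 0) (q : D[X])
    (i : ℕ) : C (q.coeff i) ∈ vcl (Ideal.span {C d, q}) := by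
  intro a b hab
  by_cases hb : b = 0
  · have := hab (C d) (Ideal.subset_span (by simp))
    simp only [hb, zero_dvd_iff, mul_eq_zero, C_eq_zero, hd, or_false] at this ⊢
    exact Or.inl this
  obtain ⟨p, hp⟩ := hab (C d) (Ideal.subset_span (by simp))
  obtain ⟨r, hr⟩ := hab q (Ideal.subset_span (by simp))
  -- As a/b = p/d, Gauss's lemma applied to pq = dr gives d ∣ p_j q_i.
  have hpq : p * q = C d * r := mul_left_cancel₀ hb (by linear_combination C d * hr - q * hp)
  have hdvd : C d ∣ p * C (q.coeff i) := by
    rw [C_dvd_iff_dvd_coeff]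
    intro j
    rw [coeff_mul_C]
    exact dvd_coeff_mul_coeff ⟨r, hpq⟩ j i
  obtain ⟨s, hs⟩ := hdvd
  have hCd : (C d : D[X]) ≠ 0 := by simpa using hd
  exact ⟨s, mul_left_cancel₀ hCd (by linear_combination C (q.coeff i) * hp + b * hs)⟩

theorem C_coeff_mem_tcl [IsDomain D] [IsIntegrallyClosed D] {d : D} (hd : d ≠ 0) {I : Ideal D[X]}
    (hdI : C d ∈ tcl I) {q : D[X]} (hq : q ∈ tcl I) (i : ℕ) : C (q.coeff i) ∈ tcl I := by
  refine tcl_le_tcl (I := Ideal.span {C d, q}) ?_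
    (vcl_le_tcl (Submodule.fg_span (by simp)) (C_coeff_mem_vcl hd q i))
  rw [Ideal.span_le, Set.pair_subset_iff]
  exact ⟨hdI, hq⟩

theorem contentIdeal_mul_le_tcl [IsDomain D] [IsIntegrallyClosed D] (p q : D[X]) :
    p.contentIdeal * q.contentIdeal ≤ tcl (p * q).contentIdeal := by
  rw [contentIdeal_def, contentIdeal_def, Ideal.span_mul_span', Ideal.span_le]
  rintro _ ⟨_, hx, _, hy, rfl⟩
  obtain ⟨i, _, rfl⟩ := mem_coeffs_iff.mp hx
  obtain ⟨j, _, rfl⟩ := mem_coeffs_iff.mp hy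
  refine vcl_le_tcl (contentIdeal_FG _) fun a b hab => ?_
  have : C b ∣ (C a * p) * q := by
    rw [mul_assoc, C_dvd_iff_dvd_coeff]
    intro n
    rw [coeff_C_mul]
    exact hab _ (coeff_mem_contentIdeal _ n)
  simpa [mul_assoc] using dvd_coeff_mul_coeff this i j

end Extension

/-! ### From D[X] to D. -/

section Descent

variable {D : Type*} [CommRing D] [IsDomain D]

theorem IsTSharp.of_polynomial (h : IsTSharp D[X]) : IsTSharp D := by
  have := h.isIntegrallyClosed
  have : IsIntegrallyClosed D := isIntegrallyClosed_of_polynomial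
  rw [isTSharp_iff] at h ⊢
  intro I A B hI hA hB hAB
  obtain ⟨H, J, hH, hJ, hHJ, hAH, hBJ⟩ := h (I.map C) (A.map C) (B.map C) (map_C_ne_bot hI)
    (map_C_ne_bot hA) (map_C_ne_bot hB) (by rw [← Ideal.map_mul]; exact Ideal.map_mono hAB)
  -- A nonzero constant of A lies in H_t, so H_t contains all coefficients of its elements and is
  -- extended from its contraction.
  have key (A : Ideal D) (hA : A ≠ ⊥) (H : Ideal D[X]) (hAH : A.map C ≤ tcl H) :
      A ≤ (tcl H).comap C ∧ (tcl H).comap C ≠ ⊥ ∧ tcl H ≤ ((tcl H).comap C).map C := by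
    have hle : A ≤ (tcl H).comap C := Ideal.map_le_iff_le_comap.mp hAH
    obtain ⟨d, hd, hd0⟩ := Submodule.exists_mem_ne_zero_of_ne_bot hA
    exact ⟨hle, fun hbot => hA (le_bot_iff.mp (hbot ▸ hle)), fun q hq =>
      Ideal.mem_map_C_iff.mpr fun n => C_coeff_mem_tcl hd0 (hle hd) hq n⟩
  obtain ⟨hA', hH', hHmap⟩ := key A hA H hAH
  obtain ⟨hB', hJ', hJmap⟩ := key B hB J hBJ
  refine ⟨_, _, hH', hJ', le_antisymm (tcl_le_tcl_of_map_le ?_) (tcl_le_tcl_of_map_le ?_),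
    hA'.trans (le_tcl _), hB'.trans (le_tcl _)⟩
  · rw [hHJ, Ideal.map_mul]
    exact tcl_mono (Ideal.mul_mono ((le_tcl H).trans hHmap) ((le_tcl J).trans hJmap))
  · rw [hHJ, Ideal.map_mul]
    exact tcl_le_tcl (mul_le_tcl_mul Ideal.map_comap_le Ideal.map_comap_le)

end Descent

variable {D : Type*} [CommRing D]

local notation "φ" => algebraMap D (FractionRing D)

/-! ### Divisibility in K[X] and contractions to D[X]. -/

section GenericDivisibility

theorem map_algebraMap_injective : Function.Injective (Polynomial.map φ) :=
  map_injective _ (IsFractionRing.injective D (FractionRing D))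

theorem map_algebraMap_ne_zero [IsDomain D] {f : D[X]} (hf : f ≠ 0) : f.map φ ≠ 0 := fun h =>
  hf (map_algebraMap_injective (by simpa using h))

theorem exists_map_eq_C_mul [IsDomain D] (F : (FractionRing D)[X]) :
    ∃ d : D, d ≠ 0 ∧ ∃ f : D[X], f.map φ = C (φ d) * F := by
  obtain ⟨d, hd, h⟩ := IsLocalization.integerNormalization_spec D⁰ F
  exact ⟨d, nonZeroDivisors.ne_zero hd, _, by rw [h, ← smul_eq_C_mul, algebraMap_smul]⟩

theorem isUnit_C_algebraMap [IsDomain D] {d : D} (hd : d ≠ 0) : IsUnit (C (φ d)) :=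
  isUnit_C.mpr (isUnit_iff_ne_zero.mpr (by simpa using hd))

theorem map_dvd_map_iff [IsDomain D] {f g : D[X]} :
    f.map φ ∣ g.map φ ↔ ∃ d : D, d ≠ 0 ∧ f ∣ C d * g := by
  constructor
  · rintro ⟨Q, hQ⟩
    obtain ⟨d, hd, q, hq⟩ := exists_map_eq_C_mul Q
    refine ⟨d, hd, q, map_algebraMap_injective ?_⟩
    rw [Polynomial.map_mul, Polynomial.map_mul, map_C, hQ, hq]
    ring
  · rintro ⟨d, hd, h⟩
    have := Polynomial.map_dvd φ h
    rwa [Polynomial.map_mul, map_C, (isUnit_C_algebraMap hd).dvd_mul_left] at this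

theorem exists_factorization_of_map_dvd_mul [IsDomain D] {f g h : D[X]} (hf : f ≠ 0)
    (hdvd : f.map φ ∣ g.map φ * h.map φ) :
    ∃ f₁ f₂ : D[X], f₁ ≠ 0 ∧ f₂ ≠ 0 ∧ f₁.map φ ∣ g.map φ ∧ f₂.map φ ∣ h.map φ ∧
      Associated (f₁.map φ * f₂.map φ) (f.map φ) := by
  obtain ⟨F₁, F₂, h₁, h₂, hF⟩ := exists_dvd_and_dvd_of_dvd_mul hdvd
  obtain ⟨d₁, hd₁, f₁, hf₁⟩ := exists_map_eq_C_mul F₁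
  obtain ⟨d₂, hd₂, f₂, hf₂⟩ := exists_map_eq_C_mul F₂
  have h₁' : Associated (f₁.map φ) F₁ := by
    rw [hf₁]
    exact associated_unit_mul_left _ _ (isUnit_C_algebraMap hd₁)
  have h₂' : Associated (f₂.map φ) F₂ := by
    rw [hf₂]
    exact associated_unit_mul_left _ _ (isUnit_C_algebraMap hd₂)
  have hassoc : Associated (f₁.map φ * f₂.map φ) (f.map φ) := hF ▸ h₁'.mul_mul h₂'
  have hne := hassoc.ne_zero_iff.mpr (map_algebraMap_ne_zero hf)
  exact ⟨f₁, f₂, fun h => hne (by simp [h]), fun h => hne (by simp [h]), h₁'.dvd.trans h₁,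
    h₂'.dvd.trans h₂, hassoc⟩

/-- A nonzero element of minimal degree works: after clearing denominators, the remainder of a
division in K[X] lies in I. -/
theorem exists_mem_forall_map_dvd_map [IsDomain D] {I : Ideal D[X]} (hI : I ≠ ⊥) :
    ∃ f ∈ I, f ≠ 0 ∧ ∀ g ∈ I, f.map φ ∣ g.map φ := by
  obtain ⟨f, ⟨hf, hf0⟩, hmin⟩ := WellFounded.has_min (measure (natDegree (R := D))).wf
    {f | f ∈ I ∧ f ≠ 0} (Submodule.exists_mem_ne_zero_of_ne_bot hI)
  refine ⟨f, hf, hf0, fun g hg => ?_⟩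
  have hφf := map_algebraMap_ne_zero hf0
  have hdiv := EuclideanDomain.div_add_mod (g.map φ) (f.map φ)
  obtain ⟨d, hd, q, hq⟩ := exists_map_eq_C_mul (g.map φ / f.map φ)
  have hr : (C d * g - f * q).map φ = C (φ d) * (g.map φ % f.map φ) := by
    rw [Polynomial.map_sub, Polynomial.map_mul, Polynomial.map_mul, map_C, hq]
    linear_combination -C (φ d) * hdiv
  by_cases hr0 : C d * g - f * q = 0
  · exact map_dvd_map_iff.mpr ⟨d, hd, q, sub_eq_zero.mp hr0⟩
  refine absurd ?_ (hmin _ ⟨sub_mem (I.mul_mem_left _ hg) (I.mul_mem_right _ hf), hr0⟩)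
  have hdeg : (C d * g - f * q).degree < f.degree := by
    rw [← degree_map_eq_of_injective (IsFractionRing.injective D (FractionRing D))
      (C d * g - f * q), hr,
      degree_C_mul (by simpa using hd),
      ← degree_map_eq_of_injective (IsFractionRing.injective D (FractionRing D)) f]
    exact EuclideanDomain.mod_lt _ hφf
  exact natDegree_lt_natDegree hr0 hdeg

/-- The contraction `f K[X] ∩ D[X]` of the ideal generated by `f` in `K[X]`. -/
noncomputable def contraction (f : D[X]) : Ideal D[X] :=
  (Ideal.span {f.map φ}).comap (mapRingHom φ)

theorem mem_contraction {f x : D[X]} : x ∈ contraction f ↔ f.map φ ∣ x.map φ := by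
  simp [contraction, Ideal.mem_comap, Ideal.mem_span_singleton]

theorem contraction_mul_contraction_le {f₁ f₂ f : D[X]} (h : f.map φ ∣ f₁.map φ * f₂.map φ) :
    contraction f₁ * contraction f₂ ≤ contraction f := by
  rw [Ideal.mul_le]
  intro r hr s hs
  rw [mem_contraction, Polynomial.map_mul] at *
  exact h.trans (mul_dvd_mul hr hs)

theorem self_mem_contraction (f : D[X]) : f ∈ contraction f := mem_contraction.mpr dvd_rfl

end GenericDivisibility

/-! ### Coefficient ideals. -/

section ContentOfIdeal

/-- The ideal of `D` generated by the coefficients of the elements of an ideal of `D[X]`. -/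
def coeffIdeal (I : Ideal D[X]) : Ideal D := Ideal.span {x | ∃ f ∈ I, ∃ n, f.coeff n = x}

theorem coeff_mem_coeffIdeal {I : Ideal D[X]} {f : D[X]} (hf : f ∈ I) (n : ℕ) :
    f.coeff n ∈ coeffIdeal I := Ideal.subset_span ⟨f, hf, n, rfl⟩

theorem contentIdeal_le_coeffIdeal {I : Ideal D[X]} {f : D[X]} (hf : f ∈ I) :
    f.contentIdeal ≤ coeffIdeal I := by
  rw [contentIdeal_def, Ideal.span_le]
  intro x hx
  obtain ⟨n, _, rfl⟩ := mem_coeffs_iff.mp hx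
  exact coeff_mem_coeffIdeal hf n

theorem contentIdeal_C_mul_le (d : D) (g : D[X]) :
    (C d * g).contentIdeal ≤ Ideal.span {d} * g.contentIdeal := by
  rw [contentIdeal_def, Ideal.span_le]
  intro x hx
  obtain ⟨n, _, rfl⟩ := mem_coeffs_iff.mp hx
  rw [coeff_C_mul]
  exact Ideal.mul_mem_mul (Ideal.mem_span_singleton_self d) (coeff_mem_contentIdeal _ n)

theorem coeffIdeal_ne_bot {I : Ideal D[X]} (hI : I ≠ ⊥) : coeffIdeal I ≠ ⊥ := by
  obtain ⟨f, hf, hf0⟩ := Submodule.exists_mem_ne_zero_of_ne_bot hI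
  intro h
  have := contentIdeal_le_coeffIdeal hf
  rw [h, le_bot_iff, contentIdeal_eq_bot_iff] at this
  exact hf0 this

theorem coeffIdeal_mul_le_tcl [IsDomain D] [IsIntegrallyClosed D] {A B I : Ideal D[X]} (h : A * B ≤ I) :
    coeffIdeal A * coeffIdeal B ≤ tcl (coeffIdeal I) := by
  rw [coeffIdeal, coeffIdeal, Ideal.span_mul_span', Ideal.span_le]
  rintro x hx
  obtain ⟨_, ⟨f, hf, i, rfl⟩, _, ⟨g, hg, j, rfl⟩, rfl⟩ := hx
  exact tcl_mono (contentIdeal_le_coeffIdeal (h (Ideal.mul_mem_mul hf hg)))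
    (contentIdeal_mul_le_tcl f g
      (Ideal.mul_mem_mul (coeff_mem_contentIdeal _ i) (coeff_mem_contentIdeal _ j)))

/-- For p ∈ f K[X] ∩ D[X] some d ≠ 0 has dp ∈ (f) ⊆ I. Hence p(d, g) ⊆ I for g ∈ I, and (d, g)_v
contains the coefficients of g. -/
theorem contraction_mul_coeffIdeal_le [IsDomain D] [IsIntegrallyClosed D] {I : Ideal D[X]} {f : D[X]}
    (hf : f ∈ I) : contraction f * (coeffIdeal I).map C ≤ tcl I := by
  rw [coeffIdeal, Ideal.map_span, Ideal.mul_le]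
  intro p hp s hs
  obtain ⟨d, hd, hdp⟩ := map_dvd_map_iff.mp (mem_contraction.mp hp)
  induction hs using Submodule.span_induction with
  | mem s hs =>
    obtain ⟨_, ⟨g, hg, n, rfl⟩, rfl⟩ := hs
    have hle : Ideal.span {p} * Ideal.span {C d, g} ≤ I := by
      rw [Ideal.span_mul_span', Ideal.span_le]
      rintro _ ⟨x, hx, y, hy, rfl⟩
      obtain rfl : x = p := hx
      rcases hy with rfl | rfl
      · change x * C d ∈ I
        rw [mul_comm]
        exact I.mem_of_dvd hdp hf
      · exact I.mul_mem_left _ hg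
    exact tcl_mono hle (mul_tcl_le _ _ (Ideal.mul_mem_mul (Ideal.mem_span_singleton_self p)
      (vcl_le_tcl (Submodule.fg_span (by simp)) (C_coeff_mem_vcl hd g n))))
  | zero => simp
  | add x y _ _ hx hy =>
    rw [mul_add]
    exact add_mem hx hy
  | smul c x _ hx =>
    rw [smul_eq_mul, mul_left_comm]
    exact Ideal.mul_mem_left _ c hx

end ContentOfIdeal

/-! ### From D to D[X]. -/

section Ascent

theorem span_singleton_mul_map_le [IsDomain D] {f : D[X]} {e : D} (he : e ≠ 0) {E : Ideal D}
    (h : f.contentIdeal * E ≤ Ideal.span {e}) :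
    Ideal.span {f} * E.map C ≤ Ideal.span {C e} * contraction f := by
  rw [Ideal.map, Ideal.span_mul_span', Ideal.span_le]
  rintro _ ⟨y, hy, _, ⟨x, hx, rfl⟩, rfl⟩
  obtain rfl : y = f := hy
  have hdvd : C e ∣ y * C x := by
    rw [C_dvd_iff_dvd_coeff]
    intro n
    rw [coeff_mul_C]
    exact Ideal.mem_span_singleton.mp (h (Ideal.mul_mem_mul (coeff_mem_contentIdeal _ n) hx))
  obtain ⟨p, hp⟩ := hdvd
  refine Ideal.mem_span_singleton_mul.mpr ⟨p, mem_contraction.mpr ?_, hp.symm⟩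
  exact map_dvd_map_iff.mpr ⟨e, he, C x, hp.symm⟩

/-- Write dg = f₁f₂q and let E_i be a t-inverse of c(f_i) up to the scalar e_i. Gauss's lemma puts
e₁e₂q in the t-closure of E₁E₂c(dg)[X]. Multiplying by f₁f₂ and using f_i E_i[X] ⊆ e_i (f_i K[X] ∩
D[X]) gives the claim times e₁e₂d, which cancels. -/
theorem IsTSharp.mem_tcl_contraction_mul [IsDomain D] (h : IsTSharp D) {f₁ f₂ g : D[X]} (hf₁ : f₁ ≠ 0)
    (hf₂ : f₂ ≠ 0)
    (hg : f₁.map φ * f₂.map φ ∣ g.map φ) :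
    g ∈ tcl (contraction f₁ * contraction f₂ * g.contentIdeal.map C) := by
  have := h.isIntegrallyClosed
  obtain ⟨e₁, E₁, he₁, hle₁, hmem₁⟩ := h.exists_mul_le_span_singleton_of_fg
    (fun h0 => hf₁ (contentIdeal_eq_bot_iff _ |>.mp h0)) (contentIdeal_FG f₁)
  obtain ⟨e₂, E₂, he₂, hle₂, hmem₂⟩ := h.exists_mul_le_span_singleton_of_fg
    (fun h0 => hf₂ (contentIdeal_eq_bot_iff _ |>.mp h0)) (contentIdeal_FG f₂)
  rw [← Polynomial.map_mul, map_dvd_map_iff] at hg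
  obtain ⟨d, hd, q, hq⟩ := hg
  have hcont : (f₁ * f₂ * q).contentIdeal.map C ≤
      Ideal.span {(C d : D[X])} * g.contentIdeal.map C := by
    rw [← hq, ← Set.image_singleton, ← Ideal.map_span, ← Ideal.map_mul]
    exact Ideal.map_mono (contentIdeal_C_mul_le d g)
  have hcontent : f₁.contentIdeal * f₂.contentIdeal * q.contentIdeal ≤
      tcl (f₁ * f₂ * q).contentIdeal :=
    (mul_le_tcl_mul (contentIdeal_mul_le_tcl f₁ f₂) (le_tcl _)).trans
      (tcl_le_tcl (contentIdeal_mul_le_tcl _ _))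
  have hq' : C (e₁ * e₂) * q ∈ tcl ((E₁ * E₂ * (f₁ * f₂ * q).contentIdeal).map C) := by
    refine map_tcl_le _ (Ideal.mem_map_C_iff.mpr fun n => ?_)
    rw [coeff_C_mul]
    have h1 : e₁ * e₂ * q.coeff n ∈
        tcl (f₁.contentIdeal * E₁ * (f₂.contentIdeal * E₂) * q.contentIdeal) :=
      mul_le_tcl_mul (tcl_mul_tcl_le _ _) (le_tcl _) (Ideal.mul_mem_mul
        (Ideal.mul_mem_mul hmem₁ hmem₂) (coeff_mem_contentIdeal _ n))
    have h2 : f₁.contentIdeal * E₁ * (f₂.contentIdeal * E₂) * q.contentIdeal =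
        E₁ * E₂ * (f₁.contentIdeal * f₂.contentIdeal * q.contentIdeal) := by ring
    rw [h2] at h1
    exact tcl_le_tcl (mul_le_tcl_mul (le_tcl _) hcontent) h1
  have hc : (C (e₁ * e₂ * d) : D[X]) ≠ 0 := by simp [he₁, he₂, hd]
  refine mem_tcl_of_mul_mem hc ?_
  have heq : C (e₁ * e₂ * d) * g = f₁ * f₂ * (C (e₁ * e₂) * q) := by
    rw [C_mul]
    linear_combination C (e₁ * e₂) * hq
  rw [heq]
  refine tcl_mono ?_ (mul_tcl_le _ _ (Ideal.mul_mem_mul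
    (Ideal.mul_mem_mul (Ideal.mem_span_singleton_self f₁) (Ideal.mem_span_singleton_self f₂)) hq'))
  calc Ideal.span {f₁} * Ideal.span {f₂} * (E₁ * E₂ * (f₁ * f₂ * q).contentIdeal).map C
      = (Ideal.span {f₁} * E₁.map C) * (Ideal.span {f₂} * E₂.map C) *
          (f₁ * f₂ * q).contentIdeal.map C := by
        rw [Ideal.map_mul, Ideal.map_mul]
        ring
    _ ≤ (Ideal.span {C e₁} * contraction f₁) * (Ideal.span {C e₂} * contraction f₂) *
          (Ideal.span {C d} * g.contentIdeal.map C) :=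
        Ideal.mul_mono (Ideal.mul_mono (span_singleton_mul_map_le he₁ hle₁)
          (span_singleton_mul_map_le he₂ hle₂)) hcont
    _ = Ideal.span {C (e₁ * e₂ * d)} *
          (contraction f₁ * contraction f₂ * g.contentIdeal.map C) := by
        rw [C_mul, C_mul, ← Ideal.span_singleton_mul_span_singleton,
          ← Ideal.span_singleton_mul_span_singleton]
        ring

theorem IsTSharp.le_tcl_contraction_mul [IsDomain D] (h : IsTSharp D) {f₁ f₂ : D[X]} (hf₁ : f₁ ≠ 0)
    (hf₂ : f₂ ≠ 0) {A : Ideal D[X]} {H : Ideal D}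
    (hA : ∀ g ∈ A, f₁.map φ * f₂.map φ ∣ g.map φ) (hAH : coeffIdeal A ≤ tcl H) :
    A ≤ tcl (contraction f₁ * contraction f₂ * H.map C) := by
  intro g hg
  have hle : g.contentIdeal.map C ≤ tcl (H.map C) :=
    map_le_tcl_map ((contentIdeal_le_coeffIdeal hg).trans hAH)
  have hle' : tcl (contraction f₁ * contraction f₂ * g.contentIdeal.map C) ≤
      tcl (contraction f₁ * contraction f₂ * H.map C) :=
    tcl_le_tcl (mul_le_tcl_mul (le_tcl _) hle)
  exact hle' (h.mem_tcl_contraction_mul hf₁ hf₂ (hA g hg))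

theorem IsTSharp.polynomial [IsDomain D] (h : IsTSharp D) : IsTSharp D[X] := by
  have := h.isIntegrallyClosed
  rw [isTSharp_iff]
  intro I A B hI hA hB hAB
  obtain ⟨f, hf, hf0, hfI⟩ := exists_mem_forall_map_dvd_map hI
  obtain ⟨a, ha, ha0, haA⟩ := exists_mem_forall_map_dvd_map hA
  obtain ⟨b, hb, hb0, hbB⟩ := exists_mem_forall_map_dvd_map hB
  have hfab := hfI _ (hAB (Ideal.mul_mem_mul ha hb))
  rw [Polynomial.map_mul] at hfab
  obtain ⟨f₁, f₂, hf₁, hf₂, h₁, h₂, hassoc⟩ := exists_factorization_of_map_dvd_mul hf0 hfab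
  -- Since c(A)c(B) is only known to lie in c(I)_t, t-sharpness of D is applied to c(I)_t.
  have hIbot : tcl (coeffIdeal I) ≠ ⊥ := fun hbot =>
    coeffIdeal_ne_bot hI (le_bot_iff.mp (hbot ▸ le_tcl _))
  obtain ⟨H, J, hH, hJ, hHJ, hAH, hBJ⟩ := isTSharp_iff.mp h _ _ _ hIbot (coeffIdeal_ne_bot hA)
    (coeffIdeal_ne_bot hB) (coeffIdeal_mul_le_tcl hAB)
  have hne {p : D[X]} (hp : p ≠ 0) {H : Ideal D} (hH : H ≠ ⊥) :
      contraction p * H.map C ≠ ⊥ :=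
    mul_ne_zero (fun h0 => hp (by
      have hmem := self_mem_contraction p
      rw [h0] at hmem
      exact hmem)) (map_C_ne_bot hH)
  have hprod : contraction f₁ * H.map C * (contraction f₂ * J.map C) =
      contraction f₁ * contraction f₂ * (H * J).map C := by
    rw [Ideal.map_mul]
    ring
  have hcover {p p' : D[X]} (hp : p ≠ 0) (hpp' : p.map φ ∣ p'.map φ)
      {A : Ideal D[X]} {H : Ideal D} (hA : ∀ g ∈ A, p'.map φ ∣ g.map φ)
      (hAH : coeffIdeal A ≤ tcl H) : A ≤ tcl (contraction p * H.map C) :=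
    -- The second polynomial is 1; its contraction is a superfluous factor.
    (h.le_tcl_contraction_mul hp one_ne_zero
      (fun g hg => by simpa using hpp'.trans (hA g hg)) hAH).trans
      (tcl_mono (Ideal.mul_mono_left Ideal.mul_le_left))
  have hcoeff : coeffIdeal I ≤ tcl (H * J) := ((le_tcl _).trans (le_tcl _)).trans hHJ.le
  have hcoeff' : H * J ≤ tcl (coeffIdeal I) := ((le_tcl _).trans hHJ.ge).trans (tcl_tcl_le _)
  refine ⟨_, _, hne hf₁ hH, hne hf₂ hJ, ?_, hcover hf₁ h₁ haA hAH, hcover hf₂ h₂ hbB hBJ⟩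
  rw [hprod]
  refine le_antisymm (tcl_le_tcl ?_) (tcl_le_tcl ?_)
  · exact h.le_tcl_contraction_mul hf₁ hf₂ (fun g hg => hassoc.dvd.trans (hfI g hg)) hcoeff
  · have hle : contraction f₁ * contraction f₂ * (H * J).map C ≤
        tcl (contraction f * (coeffIdeal I).map C) :=
      mul_le_tcl_mul ((contraction_mul_contraction_le hassoc.symm.dvd).trans (le_tcl _))
        (map_le_tcl_map hcoeff')
    exact hle.trans (tcl_le_tcl (contraction_mul_coeffIdeal_le hf))

end Ascent

end TSharp

theorem mainTheorem10 (D : Type*) [CommRing D] [IsDomain D] :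
    TSharp.IsTSharp D ↔ TSharp.IsTSharp (Polynomial D) :=
  ⟨TSharp.IsTSharp.polynomial, TSharp.IsTSharp.of_polynomial⟩
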